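/- Let $n\ge 2$ and let $[n]=\{1,\dots,n\}$ be the set of alternatives. A domain is a set $D$ of linear orders (rankings) of $[n]$. $D$ is a Condorcet domain if for every profile of an odd number of orders from $D$ the majority relation is transitive, and a maximal Condorcet domain if, in addition, it is not properly contained in another Condorcet domain on $[n]$. $D$ is an Arrow's single-peaked domain if every triple of distinct alternatives contains an alternative that no order in $D$ ranks last among the three. A maximal Arrow's single-peaked domain is an Arrow's single-peaked domain that is a maximal Condorcet domain. $D$ is $k$-rich if for every $1\le k'\le k$ and every alternative $j$ some order in $D$ gives $j$ rank $k'$ (rank $1$ being the top), and $D$ has richness $k$ if it is $k$-rich but not $(k+1)$-rich. A maximal Arrow's single-peaked domain $D$ is skewed if there is an alternative $q$ such that, for every triple of distinct alternatives containing $q$, no order in $D$ ranks $q$ last in that triple. Two domains are isomorphic if a bijective renaming of the alternatives transforms one into the other. (1) A maximal Arrow's single-peaked domain on $n$ alternatives has richness $2$ if and only if it is skewed. (2) The number of isomorphism classes of skewed maximal Arrow's single-peaked domains on $n$ alternatives equals $a(n-1)$, where $a(m)$ denotes the number of isomorphism classes of maximal Arrow's single-peaked domains on $m$ alternatives. -/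

import Mathlib

namespace ArrowSP

/-!
A preference order on the set `α` of alternatives is a linear order `P` on `α`, where
`P.lt x y` means that `x` is ranked above `y` (is preferred to `y`). A domain is a set of
preference orders.
-/

/-- The rank of the alternative `x` in the order `P`; the most preferred alternative has rank `1`. -/
noncomputable def rank {α : Type*} (P : LinearOrder α) (x : α) : ℕ :=
  Set.ncard {y : α | P.lt y x} + 1

/-- The majority relation of a profile: more agents prefer `x` to `y` than prefer `y` to `x`. -/
def Majority {α : Type*} {N : ℕ} (R : Fin N → LinearOrder α) (x y : α) : Prop :=
  Set.ncard {i : Fin N | (R i).lt y x} < Set.ncard {i : Fin N | (R i).lt x y}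

/-- A Condorcet domain: the majority relation of every profile with an odd number of agents,
all of whose preferences belong to the domain, is transitive. -/
def IsCondorcet {α : Type*} (D : Set (LinearOrder α)) : Prop :=
  ∀ (N : ℕ), Odd N → ∀ R : Fin N → LinearOrder α, (∀ i, R i ∈ D) →
    ∀ x y z : α, Majority R x y → Majority R y z → Majority R x z

/-- In no order of the domain is `x` ranked last among `x`, `y`, `z`. -/
def NeverLast {α : Type*} (D : Set (LinearOrder α)) (x y z : α) : Prop :=
  ∀ P ∈ D, ¬ (P.lt y x ∧ P.lt z x)

/-- Arrow's single-peaked domain: every triple of alternatives contains an alternative that is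
never ranked last in this triple. -/
def IsArrowSP {α : Type*} (D : Set (LinearOrder α)) : Prop :=
  ∀ a b c : α, a ≠ b → a ≠ c → b ≠ c →
    NeverLast D a b c ∨ NeverLast D b a c ∨ NeverLast D c a b

/-- A maximal Arrow's single-peaked domain: an Arrow's single-peaked domain that is a maximal
Condorcet domain (with respect to inclusion). -/
def IsMaxArrowSP {α : Type*} (D : Set (LinearOrder α)) : Prop :=
  Maximal IsCondorcet D ∧ IsArrowSP D

/-- Some alternative `q` is never ranked last in any triple containing it. -/
def IsSkewed {α : Type*} (D : Set (LinearOrder α)) : Prop :=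
  ∃ q : α, ∀ i j : α, i ≠ q → j ≠ q → i ≠ j → NeverLast D q i j

/-- Every alternative is given every rank between `1` and `k` by some order of the domain. -/
def IsRich {α : Type*} (k : ℕ) (D : Set (LinearOrder α)) : Prop :=
  ∀ k' : ℕ, 1 ≤ k' → k' ≤ k → ∀ j : α, ∃ P ∈ D, rank P j = k'

/-- The domain has richness (exactly) `k`. -/
def HasRichness {α : Type*} (k : ℕ) (D : Set (LinearOrder α)) : Prop :=
  IsRich k D ∧ ¬ IsRich (k + 1) D

/-- The order on `β` obtained from the order `P` on `α` by renaming the alternatives along the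
bijection `e`: `e x` is ranked above `e y` exactly if `x` is ranked above `y` in `P`. -/
@[reducible] def relabel {α β : Type*} (e : α ≃ β) (P : LinearOrder α) : LinearOrder β :=
  @LinearOrder.lift' β α P e.symm e.symm.injective

theorem relabel_lt {α β : Type*} (e : α ≃ β) (P : LinearOrder α) (x y : α) :
    (relabel e P).lt (e x) (e y) ↔ P.lt x y := by
  change P.lt (e.symm (e x)) (e.symm (e y)) ↔ P.lt x y
  simp

/-- Two domains are isomorphic if renaming the alternatives turns one into the other. -/
def Iso {α β : Type*} (D : Set (LinearOrder α)) (E : Set (LinearOrder β)) : Prop :=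
  ∃ e : α ≃ β, relabel e '' D = E

theorem relabel_refl {α : Type*} (P : LinearOrder α) : relabel (Equiv.refl α) P = P :=
  LinearOrder.ext_lt fun _ _ => Iff.rfl

theorem relabel_trans {α β γ : Type*} (e : α ≃ β) (f : β ≃ γ) (P : LinearOrder α) :
    relabel f (relabel e P) = relabel (e.trans f) P :=
  LinearOrder.ext_lt fun _ _ => Iff.rfl

theorem Iso.refl {α : Type*} (D : Set (LinearOrder α)) : Iso D D :=
  ⟨Equiv.refl α, by simp [relabel_refl]⟩

theorem Iso.symm {α β : Type*} {D : Set (LinearOrder α)} {E : Set (LinearOrder β)}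
    (h : Iso D E) : Iso E D := by
  obtain ⟨e, rfl⟩ := h
  exact ⟨e.symm, by simp [Set.image_image, relabel_trans, relabel_refl]⟩

theorem Iso.trans {α β γ : Type*} {D : Set (LinearOrder α)} {E : Set (LinearOrder β)}
    {F : Set (LinearOrder γ)} (h : Iso D E) (h' : Iso E F) : Iso D F := by
  obtain ⟨e, rfl⟩ := h
  obtain ⟨f, rfl⟩ := h'
  exact ⟨e.trans f, by simp [Set.image_image, relabel_trans]⟩

/-- Isomorphism of domains on `α` as an equivalence relation. -/
def isoSetoid (α : Type*) : Setoid (Set (LinearOrder α)) where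
  r D E := Iso D E
  iseqv := ⟨Iso.refl, Iso.symm, Iso.trans⟩

/-- The number of non-isomorphic domains in a class `S` of domains on `α`: the number of
isomorphism classes that meet `S`. -/
noncomputable def numNonIso {α : Type*} (S : Set (Set (LinearOrder α))) : ℕ :=
  Set.ncard ((fun D => Quotient.mk (isoSetoid α) D) '' S)

/-- The number `a(n)` of non-isomorphic maximal Arrow's single-peaked domains on `n`
alternatives. -/
noncomputable def numMaxArrowSP (n : ℕ) : ℕ :=
  numNonIso {D : Set (LinearOrder (Fin n)) | IsMaxArrowSP D}

/-- The number of non-isomorphic skewed (maximal Arrow's) single-peaked domains on `n`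
alternatives. -/
noncomputable def numSkewed (n : ℕ) : ℕ :=
  numNonIso {D : Set (LinearOrder (Fin n)) | IsMaxArrowSP D ∧ IsSkewed D}

end ArrowSP

/-! Arrow's single-peaked domains are Condorcet, so maximality forces in every order whose addition
keeps the domain Arrow's single-peaked (`IsMaxArrowSP.mem_of_forall`).

For (1), this yields a move: if something lies above `q`, some order of the domain has exactly one
alternative fewer above `q` (`IsMaxArrowSP.exists_move`). Hence ranks attained by `q` form an
initial segment, starting at 1. The move applied to the runner-up below a top `q` demotes `q`, so
2-richness is automatic, and 3-richness fails exactly when some `q` never drops below rank 2, which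
is skewness.

For (2), erasing the skew alternative `q` and inserting `q` in either of the top two places
(`skewExt`) are inverse operations preserving maximality (`IsMaxArrowSP.eq_skewExt`,
`IsMaxArrowSP.skewExt`). On three or more alternatives `q` is unique, so an isomorphism of
extensions restricts to one of the erased domains (`Iso.of_skewExt`). -/

namespace ArrowSP

/-! ### Ranks, and orders built from injective keys -/

section Orders

variable {α : Type*}

theorem lt_trichotomy_of_ne (P : LinearOrder α) {x y : α} (h : x ≠ y) : P.lt x y ∨ P.lt y x :=
  letI := P
  lt_or_gt_of_ne h

theorem lt_trans_of (P : LinearOrder α) {x y z : α} (h : P.lt x y) (h' : P.lt y z) : P.lt x z :=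
  letI := P
  lt_trans h h'

theorem not_lt_of (P : LinearOrder α) {x y : α} (h : P.lt x y) : ¬ P.lt y x :=
  letI := P
  not_lt_of_gt h

theorem ne_of_lt_of (P : LinearOrder α) {x y : α} (h : P.lt x y) : x ≠ y :=
  letI := P
  ne_of_lt h

theorem rank_lt_rank_iff [Finite α] (P : LinearOrder α) {x y : α} :
    rank P x < rank P y ↔ P.lt x y := by
  have key : ∀ {x y : α}, P.lt x y → rank P x < rank P y := by
    intro x y h
    refine Nat.succ_lt_succ (Set.ncard_lt_ncard ⟨fun z hz => lt_trans_of P hz h, fun hs => ?_⟩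
      (Set.toFinite _))
    exact ne_of_lt_of P (hs h : P.lt x x) rfl
  refine ⟨fun h => ?_, key⟩
  rcases eq_or_ne x y with rfl | hne
  · exact absurd h (lt_irrefl _)
  · exact (lt_trichotomy_of_ne P hne).resolve_right fun h' => (h.trans (key h')).false

theorem rank_injective [Finite α] (P : LinearOrder α) : Function.Injective (rank P) := by
  intro x y h
  by_contra hne
  rcases lt_trichotomy_of_ne P hne with h' | h' <;> have := (rank_lt_rank_iff P).2 h' <;> omega

/-- The order that ranks the alternatives by increasing values of `k`. -/
@[reducible] def ofKey (k : α → ℕ) (hk : Function.Injective k) : LinearOrder α :=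
  LinearOrder.lift' k hk

theorem ofKey_lt {k : α → ℕ} (hk : Function.Injective k) {x y : α} :
    (ofKey k hk).lt x y ↔ k x < k y := Iff.rfl

/-- The position of `x` after `z` has been moved to the place just below `q`. -/
noncomputable def moveKey (P : LinearOrder α) (z q x : α) : ℕ :=
  open Classical in if x = z then 2 * rank P q + 1 else 2 * rank P x

theorem moveKey_injective [Finite α] (P : LinearOrder α) (z q : α) :
    Function.Injective (moveKey P z q) := by
  intro x y h
  unfold moveKey at h
  split_ifs at h with hx hy hy
  · rw [hx, hy]
  · omega
  · omega
  · exact rank_injective P (by omega)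

end Orders

/-! ### Majority cycles and never-last conditions -/

section Condorcet

variable {α : Type*} {D : Set (LinearOrder α)}

theorem ncard_lt_add_ncard_lt {N : ℕ} (R : Fin N → LinearOrder α) {x y : α} (h : x ≠ y) :
    Set.ncard {i | (R i).lt x y} + Set.ncard {i | (R i).lt y x} = N := by
  have : {i | (R i).lt y x} = {i | (R i).lt x y}ᶜ := by
    ext i
    exact ⟨fun hi => not_lt_of _ hi, fun hi => (lt_trichotomy_of_ne (R i) h).resolve_left hi⟩
  rw [this, Set.ncard_add_ncard_compl, Nat.card_eq_fintype_card, Fintype.card_fin]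

theorem Majority.ne {N : ℕ} {R : Fin N → LinearOrder α} {x y : α} (h : Majority R x y) :
    x ≠ y := by
  rintro rfl
  exact lt_irrefl _ h

theorem majority_iff {N : ℕ} {R : Fin N → LinearOrder α} {x y : α} (h : x ≠ y) :
    Majority R x y ↔ N < 2 * Set.ncard {i | (R i).lt x y} := by
  have := ncard_lt_add_ncard_lt R h
  unfold Majority
  omega

/-- Two strict majorities of one electorate must share an agent. -/
theorem exists_lt_lt_of_majority {N : ℕ} {R : Fin N → LinearOrder α} {x y z w : α}
    (h : Majority R x y) (h' : Majority R z w) : ∃ i, (R i).lt x y ∧ (R i).lt z w := by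
  have h1 := (majority_iff h.ne).1 h
  have h2 := (majority_iff h'.ne).1 h'
  have h3 := Set.ncard_union_add_ncard_inter {i | (R i).lt x y} {i | (R i).lt z w}
  have h4 := Set.ncard_le_card ({i | (R i).lt x y} ∪ {i | (R i).lt z w})
  rw [Nat.card_eq_fintype_card, Fintype.card_fin] at h4
  have h5 : ({i | (R i).lt x y} ∩ {i | (R i).lt z w}).Nonempty := by
    rw [← Set.ncard_pos]
    omega
  exact h5

/-- An agent common to both majorities would rank `y`, `z`, `x` in this order, with `x` last. -/
theorem NeverLast.false_of_cycle {N : ℕ} {R : Fin N → LinearOrder α} (hR : ∀ i, R i ∈ D)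
    {x y z : α} (h : NeverLast D x y z) (hyz : Majority R y z) (hzx : Majority R z x) :
    False := by
  obtain ⟨i, h1, h2⟩ := exists_lt_lt_of_majority hyz hzx
  exact h _ (hR i) ⟨lt_trans_of _ h1 h2, h2⟩

theorem NeverLast.symm {x y z : α} (h : NeverLast D x y z) : NeverLast D x z y :=
  fun P hP hl => h P hP hl.symm

theorem majority_trans_of_neverLast {N : ℕ} (hN : Odd N) {R : Fin N → LinearOrder α}
    (hR : ∀ i, R i ∈ D) {x y z : α} (hxy : Majority R x y) (hyz : Majority R y z)
    (h : x ≠ z → NeverLast D x y z ∨ NeverLast D y x z ∨ NeverLast D z x y) :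
    Majority R x z := by
  have hxz : x ≠ z := by
    rintro rfl
    exact lt_asymm hxy hyz
  by_contra hcon
  have hzx : Majority R z x := by
    rw [majority_iff hxz] at hcon
    rw [majority_iff hxz.symm]
    have := ncard_lt_add_ncard_lt R hxz
    obtain ⟨k, rfl⟩ := hN
    omega
  rcases h hxz with h | h | h
  · exact h.false_of_cycle hR hyz hzx
  · exact h.symm.false_of_cycle hR hzx hxy
  · exact h.false_of_cycle hR hxy hyz

theorem IsArrowSP.isCondorcet (h : IsArrowSP D) : IsCondorcet D :=
  fun _ hN _ hR x y z hxy hyz => majority_trans_of_neverLast hN hR hxy hyz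
    fun hxz => h x y z hxy.ne hxz hyz.ne

/-- Condorcet's paradox: three agents with cyclically shifted preferences on `x`, `y`, `z` give each
step of the cycle a majority of two. -/
theorem IsCondorcet.false_of_cyclic (h : IsCondorcet D) {P Q R : LinearOrder α} (hP : P ∈ D)
    (hQ : Q ∈ D) (hR : R ∈ D) {x y z : α} (hP1 : P.lt x y) (hP2 : P.lt y z) (hQ1 : Q.lt y z)
    (hQ2 : Q.lt z x) (hR1 : R.lt z x) (hR2 : R.lt x y) : False := by
  set S : Fin 3 → LinearOrder α := ![P, Q, R] with hS
  have maj : ∀ (i j : Fin 3) (u v : α), i ≠ j → (S i).lt u v → (S j).lt u v →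
      Majority S u v := by
    intro i j u v hij hi hj
    rw [majority_iff (ne_of_lt_of _ hi)]
    have : ({i, j} : Set (Fin 3)).ncard ≤ Set.ncard {i | (S i).lt u v} := by
      refine Set.ncard_le_ncard ?_ (Set.toFinite _)
      rintro k (rfl | rfl)
      exacts [hi, hj]
    rw [Set.ncard_pair hij] at this
    omega
  have hmem : ∀ i, S i ∈ D := by
    intro i
    fin_cases i
    exacts [hP, hQ, hR]
  have h1 := h 3 (by decide) S hmem x y z (maj 0 2 x y (by decide) hP1 hR2)
    (maj 0 1 y z (by decide) hP2 hQ1)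
  exact lt_asymm h1 (maj 1 2 z x (by decide) hQ2 hR1)

end Condorcet

/-! ### Attained ranks, and richness two -/

section Richness

variable {α : Type*} {D : Set (LinearOrder α)}

theorem IsMaxArrowSP.mem_of_isArrowSP_insert (hD : IsMaxArrowSP D) {P : LinearOrder α}
    (h : IsArrowSP (insert P D)) : P ∈ D :=
  hD.1.2 h.isCondorcet (Set.subset_insert P D) (Set.mem_insert P D)

/-- An order belongs to a maximal Arrow's single-peaked domain if each of its last places in a
triple is attained in the domain or at most one alternative of the triple is last there. -/
theorem IsMaxArrowSP.mem_of_forall (hD : IsMaxArrowSP D) {P : LinearOrder α}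
    (h : ∀ x y z, y ≠ z → P.lt y x → P.lt z x →
      (∃ R ∈ D, R.lt y x ∧ R.lt z x) ∨ NeverLast D y x z ∨ NeverLast D z x y) : P ∈ D := by
  refine hD.mem_of_isArrowSP_insert fun a b c hab hac hbc => ?_
  have ins : ∀ x y z, NeverLast (insert P D) x y z ↔
      ¬ (P.lt y x ∧ P.lt z x) ∧ NeverLast D x y z := by
    intro x y z
    simp only [NeverLast, Set.forall_mem_insert]
  have key : ∀ x y z, y ≠ z → NeverLast D x y z → NeverLast (insert P D) x y z ∨
      NeverLast (insert P D) y x z ∨ NeverLast (insert P D) z x y := by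
    intro x y z hyz hx
    by_cases hl : P.lt y x ∧ P.lt z x
    · rcases h x y z hyz hl.1 hl.2 with ⟨R, hR, hR'⟩ | hy | hz
      · exact absurd hR' (hx R hR)
      -- The new order has `x` last, hence not `y`, so `y` remains never last after the insertion.
      · exact Or.inr (Or.inl ((ins y x z).2 ⟨fun h' => not_lt_of P hl.1 h'.1, hy⟩))
      · exact Or.inr (Or.inr ((ins z x y).2 ⟨fun h' => not_lt_of P hl.2 h'.1, hz⟩))
    · exact Or.inl ((ins x y z).2 ⟨hl, hx⟩)
  rcases hD.2 a b c hab hac hbc with h' | h' | h'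
  · exact key a b c hbc h'
  · rcases key b a c hac h' with h' | h' | h'
    exacts [Or.inr (Or.inl h'), Or.inl h', Or.inr (Or.inr h'.symm)]
  · rcases key c a b hab h' with h' | h' | h'
    exacts [Or.inr (Or.inr h'), Or.inl h'.symm, Or.inr (Or.inl h'.symm)]

/-- In an order of a maximal Arrow's single-peaked domain some alternative ranked above `q` can be
moved to the place just below `q`. -/
theorem IsMaxArrowSP.exists_move [Finite α] (hD : IsMaxArrowSP D) {P : LinearOrder α}
    (hP : P ∈ D) {q w : α} (hw : P.lt w q) :
    ∃ P' ∈ D, ∃ z, P.lt z q ∧ P'.lt q z ∧ ∀ y, P'.lt y q ↔ P.lt y q ∧ y ≠ z := by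
  have last : ∀ R : LinearOrder α, ∃ z, P.lt z q ∧ ∀ v, P.lt v q → rank R v ≤ rank R z := fun R =>
    Set.exists_max_image {v | P.lt v q} (rank R) (Set.toFinite _) ⟨w, hw⟩
  -- Choice of `z`: if some `R` in `D` puts `q` above a member of the set above `q` in `P`, take the
  -- last member of that set in `R`, which then lies below `q` too. Otherwise every order keeps the
  -- whole set above `q`, and `z` is its last member in `P`.
  have hRz : ∃ R ∈ D, ∃ z, P.lt z q ∧ (∀ v, P.lt v q → v ≠ z → R.lt v z) ∧
      (R.lt q z ∨ ∀ R' ∈ D, ∀ v, P.lt v q → R'.lt v q) := by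
    have strict : ∀ (R : LinearOrder α) {v z}, rank R v ≤ rank R z → v ≠ z → R.lt v z := by
      intro R v z hvz hne
      exact (rank_lt_rank_iff R).1 (lt_of_le_of_ne hvz fun h => hne (rank_injective R h))
    by_cases hB : ∃ R ∈ D, ∃ v, P.lt v q ∧ R.lt q v
    · obtain ⟨R, hR, v, hv, hqv⟩ := hB
      obtain ⟨z, hz, hmax⟩ := last R
      exact ⟨R, hR, z, hz, fun v hv => strict R (hmax v hv), Or.inl <|
        (rank_lt_rank_iff R).1 (((rank_lt_rank_iff R).2 hqv).trans_le (hmax v hv))⟩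
    · obtain ⟨z, hz, hmax⟩ := last P
      refine ⟨P, hP, z, hz, fun v hv => strict P (hmax v hv), Or.inr fun R' hR' v hv => ?_⟩
      exact (lt_trichotomy_of_ne R' (ne_of_lt_of P hv)).resolve_right
        fun h => hB ⟨R', hR', v, hv, h⟩
  obtain ⟨R, hR, z, hz, hRz, hor⟩ := hRz
  have hqz : q ≠ z := (ne_of_lt_of P hz).symm
  have kz : moveKey P z q z = 2 * rank P q + 1 := if_pos rfl
  have kne : ∀ {x}, x ≠ z → moveKey P z q x = 2 * rank P x := fun h => if_neg h
  refine ⟨ofKey _ (moveKey_injective P z q), hD.mem_of_forall ?_, z, hz, ?_, ?_⟩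
  · intro x y v hyv hyx hvx
    rw [ofKey_lt] at hyx hvx
    -- Only `z` can become last in a new triple: whatever precedes another alternative after the
    -- move already preceded it in `P`.
    by_cases hx : x = z
    · subst hx
      have hle : ∀ {u}, moveKey P x q u < moveKey P x q x → u ≠ x ∧ (u ≠ q → P.lt u q) := by
        intro u hu
        have hux : u ≠ x := by
          rintro rfl
          exact hu.false
        refine ⟨hux, fun huq => (rank_lt_rank_iff P).1 ?_⟩
        rw [kne hux, kz] at hu
        have := (rank_injective P).ne huq
        omega
      obtain ⟨hyne, hyq⟩ := hle hyx
      obtain ⟨hvne, hvq⟩ := hle hvx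
      by_cases hy : y = q
      · subst hy
        have hv := hvq hyv.symm
        -- Either `R` itself puts `z` below both `q` and `v`, or `v` is above `q` in every order and
        -- so is never last.
        rcases hor with h | h
        · exact Or.inl ⟨R, hR, h, hRz v hv hvne⟩
        · exact Or.inr (Or.inr fun R' hR' hl => not_lt_of R' hl.2 (h R' hR' v hv))
      · have hy := hyq hy
        by_cases hv : v = q
        · subst hv
          rcases hor with h | h
          · exact Or.inl ⟨R, hR, hRz y hy hyne, h⟩
          · exact Or.inr (Or.inl fun R' hR' hl => not_lt_of R' hl.2 (h R' hR' y hy))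
        · exact Or.inl ⟨R, hR, hRz y hy hyne, hRz v (hvq hv) hvne⟩
    · have hle : ∀ {u}, moveKey P z q u < moveKey P z q x → P.lt u x := by
        intro u hu
        rw [kne hx] at hu
        by_cases huz : u = z
        · subst huz
          rw [kz] at hu
          exact lt_trans_of P hz ((rank_lt_rank_iff P).1 (by omega))
        · rw [kne huz] at hu
          exact (rank_lt_rank_iff P).1 (by omega)
      exact Or.inl ⟨P, hP, hle hyx, hle hvx⟩
  · rw [ofKey_lt, kne hqz, kz]
    omega
  · intro y
    rw [ofKey_lt, kne hqz]
    by_cases hy : y = z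
    · subst hy
      rw [kz]
      simp only [ne_eq, not_true_eq_false, and_false, iff_false]
      omega
    · rw [kne hy, ← rank_lt_rank_iff P]
      simp [hy]

theorem one_le_rank (P : LinearOrder α) (x : α) : 1 ≤ rank P x := Nat.le_add_left _ _

theorem exists_lt_of_two_le_rank {P : LinearOrder α} {q : α} (h : 2 ≤ rank P q) :
    ∃ w, P.lt w q := by
  have : Set.ncard {y | P.lt y q} ≠ 0 := by
    unfold rank at h
    omega
  exact Set.nonempty_of_ncard_ne_zero this

theorem two_le_rank [Finite α] {P : LinearOrder α} {q w : α} (h : P.lt w q) : 2 ≤ rank P q :=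
  Nat.succ_le_succ ((Set.ncard_pos (Set.toFinite _)).2 ⟨w, h⟩)

theorem three_le_rank_iff [Finite α] {P : LinearOrder α} {q : α} :
    3 ≤ rank P q ↔ ∃ i j, i ≠ j ∧ P.lt i q ∧ P.lt j q := by
  have : 3 ≤ rank P q ↔ 1 < Set.ncard {y | P.lt y q} := by
    unfold rank
    omega
  rw [this, Set.one_lt_ncard]
  constructor
  · rintro ⟨i, hi, j, hj, hij⟩
    exact ⟨i, j, hij, hi, hj⟩
  · rintro ⟨i, j, hij, hi, hj⟩
    exact ⟨i, hi, j, hj, hij⟩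

theorem IsMaxArrowSP.exists_rank_eq [Finite α] (hD : IsMaxArrowSP D) {q : α} {k : ℕ}
    (hk : 1 ≤ k) : ∀ (r : ℕ) (P : LinearOrder α), P ∈ D → rank P q = r → k ≤ r →
    ∃ P' ∈ D, rank P' q = k := by
  intro r
  induction r with
  | zero => intro P _ _ h; omega
  | succ r ih =>
    intro P hP hr hkr
    rcases hkr.eq_or_lt with rfl | hlt
    · exact ⟨P, hP, hr⟩
    obtain ⟨w, hw⟩ := exists_lt_of_two_le_rank (P := P) (q := q) (by omega)
    obtain ⟨P', hP', z, hz, -, hiff⟩ := hD.exists_move hP hw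
    refine ih P' hP' ?_ (by omega)
    have hset : {y | P'.lt y q} = {y | P.lt y q} \ {z} := by
      ext y
      exact hiff y
    have := Set.ncard_sdiff_singleton_add_one (show z ∈ {y | P.lt y q} from hz) (Set.toFinite _)
    unfold rank at hr ⊢
    rw [hset]
    omega

theorem IsMaxArrowSP.nonempty [Finite α] (hD : IsMaxArrowSP D) : D.Nonempty := by
  by_contra hne
  rw [Set.not_nonempty_iff_eq_empty] at hne
  have e := (Finite.equivFin α)
  have P : LinearOrder α := ofKey (fun x => (e x : ℕ)) fun x y h => e.injective (Fin.ext h)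
  have : P ∈ D := hD.mem_of_forall fun x y z _ _ _ => by simp [hne, NeverLast]
  simp [hne] at this

theorem IsMaxArrowSP.exists_rank_eq_one [Finite α] (hD : IsMaxArrowSP D) (q : α) :
    ∃ P ∈ D, rank P q = 1 := by
  obtain ⟨P, hP⟩ := hD.nonempty
  exact hD.exists_rank_eq le_rfl _ P hP rfl (one_le_rank P q)

theorem IsMaxArrowSP.exists_top [Finite α] (hD : IsMaxArrowSP D) (q : α) :
    ∃ P ∈ D, ∀ x, x ≠ q → P.lt q x := by
  obtain ⟨P, hP, hr⟩ := hD.exists_rank_eq_one q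
  refine ⟨P, hP, fun x hx => (lt_trichotomy_of_ne P hx.symm).resolve_right fun h => ?_⟩
  have := two_le_rank h
  omega

theorem IsMaxArrowSP.exists_two_le_rank [Finite α] [Nontrivial α] (hD : IsMaxArrowSP D) (q : α) :
    ∃ P ∈ D, 2 ≤ rank P q := by
  obtain ⟨y, hy⟩ := exists_ne q
  obtain ⟨P, hP, htop⟩ := hD.exists_top q
  obtain ⟨y, hy, hmin⟩ := Set.exists_min_image {v | v ≠ q} (rank P) (Set.toFinite _) ⟨y, hy⟩
  obtain ⟨P', hP', z, hz, hyz, -⟩ := hD.exists_move hP (htop y hy)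
  -- Since `q` is top and `y` is second, only `q` lies above `y`.
  have : z = q := by
    by_contra hne
    have h1 := hmin z hne
    have h2 := (rank_lt_rank_iff P).2 hz
    omega
  exact ⟨P', hP', two_le_rank (this ▸ hyz)⟩

theorem IsMaxArrowSP.isRich_iff [Finite α] (hD : IsMaxArrowSP D) {k : ℕ} (hk : 1 ≤ k) :
    IsRich k D ↔ ∀ q, ∃ P ∈ D, k ≤ rank P q := by
  constructor
  · intro h q
    obtain ⟨P, hP, hr⟩ := h k hk le_rfl q
    exact ⟨P, hP, hr.ge⟩
  · intro h k' h1 hk' q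
    obtain ⟨P, hP, hr⟩ := h q
    exact hD.exists_rank_eq h1 _ P hP rfl (hk'.trans hr)

theorem isSkewed_iff [Finite α] : IsSkewed D ↔ ∃ q, ∀ P ∈ D, ¬ 3 ≤ rank P q := by
  refine exists_congr fun q => ?_
  simp only [three_le_rank_iff]
  constructor
  · rintro h P hP ⟨i, j, hij, hi, hj⟩
    exact h i j (ne_of_lt_of P hi) (ne_of_lt_of P hj) hij P hP ⟨hi, hj⟩
  · intro h i j _ _ hij P hP hl
    exact h P hP ⟨i, j, hij, hl⟩

theorem IsMaxArrowSP.hasRichness_two_iff_isSkewed [Finite α] [Nontrivial α]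
    (hD : IsMaxArrowSP D) : HasRichness 2 D ↔ IsSkewed D := by
  have h2 : IsRich 2 D := (hD.isRich_iff one_le_two).2 hD.exists_two_le_rank
  rw [HasRichness, and_iff_right h2, hD.isRich_iff (by omega), isSkewed_iff]
  push Not
  rfl

end Richness

/-! ### Skewed domains as extensions by one alternative -/

section Skew

variable {m : ℕ}

/-- The order of the alternatives other than `q`. -/
@[reducible] def eraseOrder (q : Fin (m + 1)) (P : LinearOrder (Fin (m + 1))) :
    LinearOrder (Fin m) :=
  @LinearOrder.lift' (Fin m) (Fin (m + 1)) P q.succAbove Fin.succAbove_right_injective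

/-- The orders that extend an order of `E` by the alternative `q` in one of the top two places. -/
def skewExt (q : Fin (m + 1)) (E : Set (LinearOrder (Fin m))) :
    Set (LinearOrder (Fin (m + 1))) :=
  {P | eraseOrder q P ∈ E ∧ ∀ i j, i ≠ j → ¬ (P.lt i q ∧ P.lt j q)}

theorem neverLast_skewExt {q : Fin (m + 1)} {E : Set (LinearOrder (Fin m))} {i j : Fin (m + 1)}
    (h : i ≠ j) : NeverLast (skewExt q E) q i j :=
  fun _ hP => hP.2 i j h

/-- Stated for all Condorcet `E`, not only Arrow's single-peaked ones, because maximality compares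
with arbitrary Condorcet domains. -/
theorem isCondorcet_skewExt (q : Fin (m + 1)) {E : Set (LinearOrder (Fin m))}
    (hE : IsCondorcet E) : IsCondorcet (skewExt q E) := by
  intro N hN R hR x y z hxy hyz
  by_cases hq : x = q ∨ y = q ∨ z = q
  · refine majority_trans_of_neverLast hN hR hxy hyz fun hxz => ?_
    rcases hq with rfl | rfl | rfl
    exacts [Or.inl (neverLast_skewExt hyz.ne), Or.inr (Or.inl (neverLast_skewExt hxz)),
      Or.inr (Or.inr (neverLast_skewExt hxy.ne))]
  · push Not at hq
    obtain ⟨x, rfl⟩ := Fin.exists_succAbove_eq hq.1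
    obtain ⟨y, rfl⟩ := Fin.exists_succAbove_eq hq.2.1
    obtain ⟨z, rfl⟩ := Fin.exists_succAbove_eq hq.2.2
    exact hE N hN (fun i => eraseOrder q (R i)) (fun i => (hR i).1) x y z hxy hyz

theorem isArrowSP_skewExt (q : Fin (m + 1)) {E : Set (LinearOrder (Fin m))}
    (hE : IsArrowSP E) : IsArrowSP (skewExt q E) := by
  intro x y z hxy hxz hyz
  by_cases hq : x = q ∨ y = q ∨ z = q
  · rcases hq with rfl | rfl | rfl
    exacts [Or.inl (neverLast_skewExt hyz), Or.inr (Or.inl (neverLast_skewExt hxz)),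
      Or.inr (Or.inr (neverLast_skewExt hxy))]
  · push Not at hq
    obtain ⟨x, rfl⟩ := Fin.exists_succAbove_eq hq.1
    obtain ⟨y, rfl⟩ := Fin.exists_succAbove_eq hq.2.1
    obtain ⟨z, rfl⟩ := Fin.exists_succAbove_eq hq.2.2
    have lift : ∀ {x y z}, NeverLast E x y z →
        NeverLast (skewExt q E) (q.succAbove x) (q.succAbove y) (q.succAbove z) :=
      fun h P hP => h _ hP.1
    exact (hE x y z (ne_of_apply_ne _ hxy) (ne_of_apply_ne _ hxz) (ne_of_apply_ne _ hyz)).imp lift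
      (Or.imp lift lift)

theorem isCondorcet_eraseOrder_image (q : Fin (m + 1)) {D : Set (LinearOrder (Fin (m + 1)))}
    (hD : IsCondorcet D) : IsCondorcet (eraseOrder q '' D) := by
  intro N hN R hR x y z hxy hyz
  choose S hS hSR using hR
  obtain rfl : (fun i => eraseOrder q (S i)) = R := funext hSR
  exact hD N hN S hS _ _ _ hxy hyz

theorem isArrowSP_eraseOrder_image (q : Fin (m + 1)) {D : Set (LinearOrder (Fin (m + 1)))}
    (hD : IsArrowSP D) : IsArrowSP (eraseOrder q '' D) := by
  intro x y z hxy hxz hyz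
  have lower : ∀ {x y z}, NeverLast D (q.succAbove x) (q.succAbove y) (q.succAbove z) →
      NeverLast (eraseOrder q '' D) x y z := by
    rintro x y z h _ ⟨P, hP, rfl⟩
    exact h P hP
  have inj := Fin.succAbove_right_injective (p := q)
  exact (hD _ _ _ (inj.ne hxy) (inj.ne hxz) (inj.ne hyz)).imp lower (Or.imp lower lower)

/-- The position of an alternative after `q` has been inserted into `P` just below the alternative
of rank `r`. -/
noncomputable def insertKey (q : Fin (m + 1)) (P : LinearOrder (Fin m)) (r : ℕ) :
    Fin (m + 1) → ℕ :=
  q.insertNth (2 * r + 1) fun x => 2 * rank P x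

theorem insertKey_self (q : Fin (m + 1)) (P : LinearOrder (Fin m)) (r : ℕ) :
    insertKey q P r q = 2 * r + 1 :=
  Fin.insertNth_apply_same (α := fun _ => ℕ) q _ _

theorem insertKey_succAbove (q : Fin (m + 1)) (P : LinearOrder (Fin m)) (r : ℕ) (x : Fin m) :
    insertKey q P r (q.succAbove x) = 2 * rank P x :=
  Fin.insertNth_apply_succAbove (α := fun _ => ℕ) q _ _ _

theorem insertKey_injective (q : Fin (m + 1)) (P : LinearOrder (Fin m)) (r : ℕ) :
    Function.Injective (insertKey q P r) := by
  intro x y h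
  rcases Fin.eq_self_or_eq_succAbove q x with hx | ⟨x, rfl⟩ <;>
    rcases Fin.eq_self_or_eq_succAbove q y with hy | ⟨y, rfl⟩
  all_goals simp only [*, insertKey_self, insertKey_succAbove] at h
  · rw [hx, hy]
  · omega
  · omega
  · rw [rank_injective P (by omega : rank P x = rank P y)]

/-- The order obtained from `P` by inserting `q` just below the alternative of rank `r`. -/
@[reducible] noncomputable def insertOrder (q : Fin (m + 1)) (P : LinearOrder (Fin m)) (r : ℕ) :
    LinearOrder (Fin (m + 1)) :=
  ofKey _ (insertKey_injective q P r)

theorem eraseOrder_insertOrder (q : Fin (m + 1)) (P : LinearOrder (Fin m)) (r : ℕ) :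
    eraseOrder q (insertOrder q P r) = P := by
  refine LinearOrder.ext_lt fun x y => ?_
  change insertKey q P r _ < insertKey q P r _ ↔ _
  rw [insertKey_succAbove, insertKey_succAbove]
  exact (Nat.mul_lt_mul_left two_pos).trans (rank_lt_rank_iff P)

theorem insertOrder_mem_skewExt (q : Fin (m + 1)) {E : Set (LinearOrder (Fin m))}
    {P : LinearOrder (Fin m)} (hP : P ∈ E) {r : ℕ} (hr : r ≤ 1) :
    insertOrder q P r ∈ skewExt q E := by
  refine ⟨(eraseOrder_insertOrder q P r).symm ▸ hP, ?_⟩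
  rintro i j hij ⟨hi, hj⟩
  rcases Fin.eq_self_or_eq_succAbove q i with rfl | ⟨i, rfl⟩
  · exact ne_of_lt_of (insertOrder _ P r) hi rfl
  rcases Fin.eq_self_or_eq_succAbove q j with rfl | ⟨j, rfl⟩
  · exact ne_of_lt_of (insertOrder _ P r) hj rfl
  rw [ofKey_lt, insertKey_self, insertKey_succAbove] at hi hj
  have h1 := one_le_rank P i
  have h2 := one_le_rank P j
  exact hij (by rw [rank_injective P (by omega : rank P i = rank P j)])

theorem eraseOrder_image_skewExt (q : Fin (m + 1)) (E : Set (LinearOrder (Fin m))) :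
    eraseOrder q '' skewExt q E = E := by
  refine Set.Subset.antisymm ?_ fun P hP => ?_
  · rintro _ ⟨P, hP, rfl⟩
    exact hP.1
  · exact ⟨_, insertOrder_mem_skewExt q hP zero_le_one, eraseOrder_insertOrder q P 0⟩

theorem subset_skewExt_eraseOrder_image {q : Fin (m + 1)} {D : Set (LinearOrder (Fin (m + 1)))}
    (hq : ∀ i j, i ≠ q → j ≠ q → i ≠ j → NeverLast D q i j) :
    D ⊆ skewExt q (eraseOrder q '' D) :=
  fun P hP => ⟨⟨P, hP, rfl⟩, fun i j hij h =>
    hq i j (ne_of_lt_of P h.1) (ne_of_lt_of P h.2) hij P hP h⟩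

theorem skewExt_mono (q : Fin (m + 1)) {E F : Set (LinearOrder (Fin m))} (h : E ⊆ F) :
    skewExt q E ⊆ skewExt q F :=
  fun _ hP => ⟨h hP.1, hP.2⟩

theorem IsMaxArrowSP.eq_skewExt {q : Fin (m + 1)} {D : Set (LinearOrder (Fin (m + 1)))}
    (hD : IsMaxArrowSP D) (hq : ∀ i j, i ≠ q → j ≠ q → i ≠ j → NeverLast D q i j) :
    D = skewExt q (eraseOrder q '' D) :=
  (subset_skewExt_eraseOrder_image hq).antisymm <|
    hD.1.2 (isCondorcet_skewExt q (isCondorcet_eraseOrder_image q hD.1.1))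
      (subset_skewExt_eraseOrder_image hq)

/-- A Condorcet domain larger than the erased one extends to a Condorcet domain containing `D`,
which maximality collapses to `D`; erasing `q` again gives the claim. -/
theorem IsMaxArrowSP.eraseOrder_image {q : Fin (m + 1)} {D : Set (LinearOrder (Fin (m + 1)))}
    (hD : IsMaxArrowSP D) (hq : ∀ i j, i ≠ q → j ≠ q → i ≠ j → NeverLast D q i j) :
    IsMaxArrowSP (eraseOrder q '' D) := by
  refine ⟨⟨isCondorcet_eraseOrder_image q hD.1.1, fun E hE hDE => ?_⟩,
    isArrowSP_eraseOrder_image q hD.2⟩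
  have h := hD.1.2 (isCondorcet_skewExt q hE)
    ((subset_skewExt_eraseOrder_image hq).trans (skewExt_mono q hDE))
  exact (eraseOrder_image_skewExt q E).symm.subset.trans (Set.image_mono h)

theorem IsMaxArrowSP.skewExt (q : Fin (m + 1)) {E : Set (LinearOrder (Fin m))}
    (hE : IsMaxArrowSP E) : IsMaxArrowSP (skewExt q E) := by
  refine ⟨⟨isCondorcet_skewExt q hE.1.1, fun D hD hED => ?_⟩, isArrowSP_skewExt q hE.2⟩
  have herase : eraseOrder q '' D ⊆ E := hE.1.2 (isCondorcet_eraseOrder_image q hD)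
    ((eraseOrder_image_skewExt q E).symm.subset.trans (Set.image_mono hED))
  have last : ∀ i j, i ≠ q → j ≠ q → ∀ P ∈ D, P.lt i j → P.lt j q → False := by
    intro i j hi hj P hP hij hjq
    have hne := ne_of_lt_of P hij
    obtain ⟨i, rfl⟩ := Fin.exists_succAbove_eq hi
    obtain ⟨j, rfl⟩ := Fin.exists_succAbove_eq hj
    have hne : i ≠ j := ne_of_apply_ne _ hne
    obtain ⟨Pj, hPj, hrj⟩ := hE.exists_rank_eq_one j
    obtain ⟨Pi, hPi, hri⟩ := hE.exists_rank_eq_one i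
    have h1 := one_le_rank Pj i
    have h2 := one_le_rank Pi j
    have h3 := (rank_injective Pj).ne hne
    have h4 := (rank_injective Pi).ne hne
    -- An order with `i`, `j`, `q` in descending preference completes a Condorcet cycle with two
    -- members of the extension: `j` top and `q` second, and `q` top with `i` second.
    refine hD.false_of_cyclic hP (hED (insertOrder_mem_skewExt q hPj le_rfl))
      (hED (insertOrder_mem_skewExt q hPi zero_le_one)) hij hjq ?_ ?_ ?_ ?_
    all_goals
      rw [ofKey_lt]
      simp only [insertKey_self, insertKey_succAbove]
      omega
  refine (subset_skewExt_eraseOrder_image fun i j hi hj hij P hP h => ?_).trans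
    (skewExt_mono q herase)
  rcases lt_trichotomy_of_ne P hij with h' | h'
  exacts [last i j hi hj P hP h' h.2, last j i hj hi P hP h' h.1]

theorem eraseOrder_relabel {q q' : Fin (m + 1)} {e : Fin m ≃ Fin m}
    {f : Fin (m + 1) ≃ Fin (m + 1)} (hf : ∀ x, f (q.succAbove x) = q'.succAbove (e x))
    (P : LinearOrder (Fin (m + 1))) :
    eraseOrder q' (relabel f P) = relabel e (eraseOrder q P) := by
  refine LinearOrder.ext_lt fun x y => ?_
  obtain ⟨x, rfl⟩ := e.surjective x
  obtain ⟨y, rfl⟩ := e.surjective y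
  refine Iff.trans ?_ (relabel_lt e (eraseOrder q P) x y).symm
  refine Iff.trans ?_ (relabel_lt f P _ _)
  rw [hf, hf]
  exact Iff.rfl

theorem relabel_mem_image_iff {α β : Type*} (e : α ≃ β) {D : Set (LinearOrder α)}
    {P : LinearOrder α} : relabel e P ∈ relabel e '' D ↔ P ∈ D := by
  refine ⟨?_, fun h => ⟨P, h, rfl⟩⟩
  rintro ⟨Q, hQ, h⟩
  have : Q = P := by
    simpa [relabel_trans, relabel_refl] using congrArg (relabel e.symm) h
  exact this ▸ hQ

theorem relabel_relabel_symm {α β : Type*} (e : α ≃ β) (P : LinearOrder β) :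
    relabel e (relabel e.symm P) = P := by
  simp [relabel_trans, relabel_refl]

theorem relabel_image_skewExt {q q' : Fin (m + 1)} {e : Fin m ≃ Fin m}
    {f : Fin (m + 1) ≃ Fin (m + 1)} (hq : f q = q')
    (hf : ∀ x, f (q.succAbove x) = q'.succAbove (e x)) (E : Set (LinearOrder (Fin m))) :
    relabel f '' skewExt q E = skewExt q' (relabel e '' E) := by
  have key : ∀ P, relabel f P ∈ skewExt q' (relabel e '' E) ↔ P ∈ skewExt q E := by
    intro P
    subst hq
    refine and_congr ?_ ?_
    · rw [eraseOrder_relabel hf, relabel_mem_image_iff]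
    · rw [f.symm.forall_congr_left]
      refine forall_congr' fun i => ?_
      rw [f.symm.forall_congr_left]
      refine forall_congr' fun j => ?_
      rw [f.symm_symm, relabel_lt, relabel_lt, f.injective.ne_iff]
  ext P
  rw [← relabel_relabel_symm f P, relabel_mem_image_iff, key]

theorem Iso.skewExt {E F : Set (LinearOrder (Fin m))} (h : Iso E F) (q q' : Fin (m + 1)) :
    Iso (skewExt q E) (skewExt q' F) := by
  obtain ⟨e, rfl⟩ := h
  refine ⟨((finSuccEquiv' q).trans e.optionCongr).trans (finSuccEquiv' q').symm,
    relabel_image_skewExt ?_ ?_ E⟩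
  · simp
  · intro x
    simp

theorem Iso.of_skewExt {E F : Set (LinearOrder (Fin m))} (hE : IsMaxArrowSP E)
    (hF : IsMaxArrowSP F) {q q' : Fin (m + 1)}
    (h : Iso (ArrowSP.skewExt q E) (ArrowSP.skewExt q' F)) : Iso E F := by
  rcases subsingleton_or_nontrivial (Fin m) with hs | hn
  -- With at most one alternative there are no triples, so a maximal domain contains every order.
  · have univ : ∀ {D : Set (LinearOrder (Fin m))}, IsMaxArrowSP D → D = Set.univ := fun hD =>
      Set.eq_univ_of_forall fun P => hD.mem_of_forall fun _ y z hyz =>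
        absurd (Subsingleton.elim y z) hyz
    rw [univ hE, univ hF]
    exact Iso.refl _
  · obtain ⟨f, hf⟩ := h
    have hq : f q = q' := by
      -- If `f q` and `q'` differed, neither could fall below rank 2 in the common domain; yet an
      -- order with a third alternative on top gives one of them rank at least 3.
      by_contra hne
      obtain ⟨x, hx⟩ := Fin.exists_succAbove_eq hne
      obtain ⟨y, hy⟩ := exists_ne x
      obtain ⟨P, hP, hr⟩ := (hF.skewExt q').exists_top (q'.succAbove y)
      have hP' := hP
      rw [← hf] at hP
      obtain ⟨Q, hQ, rfl⟩ := hP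
      have hyx : q'.succAbove y ≠ f q := hx ▸ Fin.succAbove_right_injective.ne hy
      have hyq : q'.succAbove y ≠ q' := Fin.succAbove_ne q' y
      have h1 := hr _ hyx.symm
      have h2 := hr _ hyq.symm
      rcases lt_trichotomy_of_ne (relabel f Q) hne with h3 | h3
      · exact hP'.2 _ _ hyx ⟨h2, h3⟩
      · refine hQ.2 (f.symm (q'.succAbove y)) (f.symm q') (f.symm.injective.ne hyq) ⟨?_, ?_⟩ <;>
          rw [← relabel_lt f] <;> simpa
    have hfne : ∀ x, f (q.succAbove x) ≠ q' := fun x =>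
      hq ▸ f.injective.ne (Fin.succAbove_ne q x)
    choose g hg using fun x => Fin.exists_succAbove_eq (hfne x)
    have hginj : Function.Injective g := by
      intro x y h
      have : f (q.succAbove x) = f (q.succAbove y) := by rw [← hg, ← hg, h]
      exact Fin.succAbove_right_injective (f.injective this)
    let e : Fin m ≃ Fin m := Equiv.ofBijective g (Finite.injective_iff_bijective.1 hginj)
    refine ⟨e, ?_⟩
    rw [← eraseOrder_image_skewExt q' F, ← hf, relabel_image_skewExt (e := e) hq
      (fun x => (hg x).symm), eraseOrder_image_skewExt]

theorem numSkewed_succ (m : ℕ) : numSkewed (m + 1) = numMaxArrowSP m := by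
  let F : Quotient (isoSetoid (Fin m)) → Quotient (isoSetoid (Fin (m + 1))) :=
    Quotient.map (sa := isoSetoid (Fin m)) (sb := isoSetoid (Fin (m + 1))) (skewExt 0)
      fun _ _ h => Iso.skewExt h 0 0
  have hinj : Set.InjOn F ((fun D => Quotient.mk (isoSetoid (Fin m)) D) '' {D | IsMaxArrowSP D}) := by
    rintro _ ⟨D, hD, rfl⟩ _ ⟨E, hE, rfl⟩ h
    exact Quotient.sound (s := isoSetoid (Fin m)) (Iso.of_skewExt hD hE (Quotient.exact h))
  unfold numSkewed numMaxArrowSP numNonIso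
  rw [← hinj.ncard_image]
  congr 1
  ext c
  constructor
  · rintro ⟨D, ⟨hD, q, hq⟩, rfl⟩
    refine ⟨_, ⟨_, hD.eraseOrder_image hq, rfl⟩, ?_⟩
    refine Quotient.sound (s := isoSetoid (Fin (m + 1))) ?_
    -- The skew alternative may be any `q`; up to isomorphism it can be taken to be `0`.
    have := (Iso.refl (eraseOrder q '' D)).skewExt 0 q
    rwa [← hD.eq_skewExt hq] at this
  · rintro ⟨_, ⟨D, hD, rfl⟩, rfl⟩
    exact ⟨skewExt 0 D, ⟨hD.skewExt 0, 0, fun _ _ _ _ h => neverLast_skewExt h⟩, rfl⟩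

end Skew

end ArrowSP

theorem mainTheorem2 (n : ℕ) (hn : 2 ≤ n) :
    (∀ D : Set (LinearOrder (Fin n)), ArrowSP.IsMaxArrowSP D →
      (ArrowSP.HasRichness 2 D ↔ ArrowSP.IsSkewed D)) ∧
    ArrowSP.numSkewed n = ArrowSP.numMaxArrowSP (n - 1) := by
  obtain ⟨m, rfl⟩ : ∃ m, n = m + 1 := ⟨n - 1, by omega⟩
  have : Nontrivial (Fin (m + 1)) := Fin.nontrivial_iff_two_le.2 hn
  exact ⟨fun D hD => hD.hasRichness_two_iff_isSkewed, ArrowSP.numSkewed_succ m⟩
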